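/- Let $\mathbb{F}$ be a field of characteristic $0$ and let $K$ be a finite group. \emph{Groups over $K$.} The category $\mathsf{grp}_{\Downarrow K}$ has as objects the finite groups over $K$, i.e. the pairs $(L,\varphi)$ with $L$ a finite group and $\varphi:L\to K$ a group homomorphism. A morphism $(L,\varphi)\to(L',\varphi')$ is a group homomorphism $f:L\to L'$ such that $i\circ\varphi=\varphi'\circ f$ for some inner automorphism $i$ of $K$. We call $(L',\varphi')$ a \emph{quotient} of $(L,\varphi)$ if there is such a morphism with $f$ surjective. For a normal subgroup $N$ of a finite group $L$ let $$m_{L,N}=\frac1{|L|}\sum_{X\le L,\;XN=L}|X|\,\mu(X,L),$$ where $\mu$ is the Möbius function of the poset of subgroups of $L$. A group $(L,\varphi)$ over $K$ is a \emph{$B_K$-group} if $m_{L,N}=0$ for every non-trivial normal subgroup $N$ of $L$ contained in $\ker\varphi$. If $Q\le\ker\varphi$ is a normal subgroup of $L$, let $\varphi/Q:L/Q\to K$ be the homomorphism induced by $\varphi$. \emph{Ideals.} For a finite group $G$ let $\mathbb{F}B(G)=\mathbb{F}\otimes_{\mathbb{Z}}B(G)$, where $B(G)$ is the Grothendieck group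 of finite $G$-sets. The shifted Burnside functor $\mathbb{F}B_K$ is given by $\mathbb{F}B_K(G)=\mathbb{F}B(G\times K)$. A finite $(H,G)$-biset $U$ acts by the linear map $\mathbb{F}B_K(U):[X]\mapsto[(U\times K)\times_{G\times K}X]$ from $\mathbb{F}B_K(G)$ to $\mathbb{F}B_K(H)$, where $K$ acts on the second component of $U\times K$ by left and right multiplication. The products $\mathbb{F}B_K(G)\times\mathbb{F}B_K(H)\to\mathbb{F}B_K(G\times H)$ are the bilinear maps sending $([X],[Y])$ to $[X\times Y]$, with the action $(g,h,k)(x,y)=((g,k)x,(h,k)y)$. An \emph{ideal} $I$ of $\mathbb{F}B_K$ consists of subspaces $I(G)\subseteq\mathbb{F}B_K(G)$, for all finite groups $G$, that are stable under the maps $\mathbb{F}B_K(U)$ for all finite bisets $U$ and such that the product sends $\mathbb{F}B_K(G)\times I(H)$ into $I(G\times H)$ for all finite groups $G,H$. For a subgroup $M$ of a finite group $G$ let $$e_M^{G}=\frac1{|N_{G}(M)|}\sum_{X\le M}|X|\,\mu(X,M)\,[G/X]\in\mathbb{F}B(G).$$ For a group $(L,\varphi)$ over $K$ let $\mathsf{e}_{L,\varphi}$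 be the ideal of $\mathbb{F}B_K$ generated by $e_{L_\varphi}^{L\times K}\in\mathbb{F}B_K(L)$, where $L_\varphi=\{(l,\varphi(l))\mid l\in L\}$. \textbf{Corollary.} Let $(L,\varphi)$ be a group over $K$. There is a normal subgroup $Q$ of $L$ which is contained in $\ker\varphi$ and maximal, among the normal subgroups of $L$ contained in $\ker\varphi$, such that $m_{L,Q}\ne0$. For such a $Q$ put $\beta_K(L,\varphi)=(L/Q,\varphi/Q)$. Then: \begin{enumerate} \item $\beta_K(L,\varphi)$ is well defined up to isomorphism in $\mathsf{grp}_{\Downarrow K}$: any two choices of $Q$ give isomorphic groups over $K$. \item $\beta_K(L,\varphi)$ is a $B_K$-group and a quotient of $(L,\varphi)$. \item If $(P,\psi)$ is a $B_K$-group which is a quotient of $(L,\varphi)$, then $(P,\psi)$ is a quotient of $\beta_K(L,\varphi)$. \item $\mathsf{e}_{L,\varphi}=\mathsf{e}_{\beta_K(L,\varphi)}$. \end{enumerate} -/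

import Mathlib

open CategoryTheory

universe u v

/-! ## Finite `G`-sets and bisets -/

/-- A finite (left) `G`-set. -/
structure FinGSet (G : Type u) [Group G] where
  carrier : Type u
  [finite : Finite carrier]
  [action : MulAction G carrier]

attribute [instance] FinGSet.finite FinGSet.action

namespace FinGSet

variable {G H : Type u} [Group G] [Group H]

/-- Isomorphism of `G`-sets. -/
def Equivalent (X Y : FinGSet G) : Prop :=
  ∃ f : X.carrier ≃ Y.carrier, ∀ (g : G) (x : X.carrier), f (g • x) = g • f x

/-- The disjoint union of two `G`-sets. -/
def disjUnion (X Y : FinGSet G) : FinGSet G where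
  carrier := X.carrier ⊕ Y.carrier
  action :=
    { smul := fun g => Sum.map (fun x => g • x) (fun y => g • y)
      one_smul := by
        rintro (x | y)
        · exact congrArg Sum.inl (one_smul G x)
        · exact congrArg Sum.inr (one_smul G y)
      mul_smul := by
        rintro g h (x | y)
        · exact congrArg Sum.inl (mul_smul g h x)
        · exact congrArg Sum.inr (mul_smul g h y) }

/-- The transitive `G`-set `G/X` of left cosets of a subgroup `X`. -/
def coset [Finite G] (X : Subgroup G) : FinGSet G where
  carrier := G ⧸ X

end FinGSet

/-- A finite `(H, G)`-biset: a finite set with commuting left action of `H` and right action of `G`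
(a right action of `G` is a left action of the opposite group). -/
structure FinBiset (H G : Type u) [Group H] [Group G] where
  carrier : Type u
  [finite : Finite carrier]
  [left : MulAction H carrier]
  [right : MulAction Gᵐᵒᵖ carrier]
  [comm : SMulCommClass H Gᵐᵒᵖ carrier]

attribute [instance] FinBiset.finite FinBiset.left FinBiset.right FinBiset.comm

namespace FinBiset

open MulOpposite

variable {H G : Type u} [Group H] [Group G]

/-- The equivalence relation on `U × X` whose classes are the orbits of the action
`g : (u, x) ↦ (u g, g⁻¹ x)` of `G`. -/
def tensorSetoid (U : FinBiset H G) (X : FinGSet G) : Setoid (U.carrier × X.carrier) where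
  r p q := ∃ g : G, q = (op g • p.1, g⁻¹ • p.2)
  iseqv :=
    { refl := fun p => ⟨1, by simp⟩
      symm := by
        rintro p q ⟨g, rfl⟩
        exact ⟨g⁻¹, by simp [smul_smul]⟩
      trans := by
        rintro p q r ⟨g, rfl⟩ ⟨h, rfl⟩
        exact ⟨g * h, by simp [smul_smul]⟩ }

/-- The `H`-set `U ×_G X`, for an `(H, G)`-biset `U` and a `G`-set `X`. -/
def tensor (U : FinBiset H G) (X : FinGSet G) : FinGSet H where
  carrier := Quotient (U.tensorSetoid X)
  action :=
    { smul := fun h => Quotient.map (fun p => (h • p.1, p.2)) (by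
        rintro p q ⟨g, rfl⟩
        exact ⟨g, by simp [smul_comm h (op g) p.1]⟩)
      one_smul := by
        rintro ⟨p⟩
        exact congrArg (Quotient.mk _) (Prod.ext (one_smul H p.1) rfl)
      mul_smul := by
        rintro h h' ⟨p⟩
        exact congrArg (Quotient.mk _) (Prod.ext (mul_smul h h' p.1) rfl) }

/-- The `(H × K, G × K)`-biset `U × K`, with `(h, k) (u, x) (g, k') = (h u g, k x k')`. -/
def prodGroup (U : FinBiset H G) (K : Type u) [Group K] [Finite K] :
    FinBiset (H × K) (G × K) where
  carrier := U.carrier × K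
  left :=
    { smul := fun a p => (a.1 • p.1, a.2 * p.2)
      one_smul := fun p => Prod.ext (one_smul H p.1) (one_mul p.2)
      mul_smul := fun a b p => Prod.ext (mul_smul a.1 b.1 p.1) (mul_assoc a.2 b.2 p.2) }
  right :=
    { smul := fun b p => (op b.unop.1 • p.1, p.2 * b.unop.2)
      one_smul := fun p => Prod.ext (one_smul Gᵐᵒᵖ p.1) (mul_one p.2)
      mul_smul := fun a b p =>
        Prod.ext (mul_smul (op a.unop.1) (op b.unop.1) p.1)
          (mul_assoc p.2 b.unop.2 a.unop.2).symm }
  comm := @SMulCommClass.mk _ _ _ (_) (_) fun a b p =>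
    Prod.ext (smul_comm a.1 (op b.unop.1) p.1) (mul_assoc a.2 p.2 b.unop.2).symm

end FinBiset

/-! ## The Burnside functor -/

section Burnside

variable (R : Type v) [CommRing R] (G : Type u) [Group G]

/-- The relations `[X] = [Y]` for `X ≅ Y`, and `[X ⊔ Y] = [X] + [Y]`. -/
noncomputable def burnsideRelations : Submodule R (FinGSet G →₀ R) :=
  Submodule.span R
    ({r | ∃ X Y : FinGSet G, X.Equivalent Y ∧
        r = Finsupp.single X 1 - Finsupp.single Y 1} ∪
     {r | ∃ X Y : FinGSet G,
        r = Finsupp.single (X.disjUnion Y) 1 - (Finsupp.single X 1 + Finsupp.single Y 1)})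

/-- The Burnside module `RB(G) = R ⊗ B(G)`, where `B(G)` is the Grothendieck group of finite
`G`-sets for disjoint union. It is presented over `R` by the generators and relations
that present `B(G)` over `ℤ`. -/
abbrev Burnside : Type (max (u + 1) v) := (FinGSet G →₀ R) ⧸ burnsideRelations R G

variable {G}

/-- The class of a finite `G`-set. -/
noncomputable def Burnside.cls (X : FinGSet G) : Burnside R G :=
  Submodule.Quotient.mk (Finsupp.single X 1)

variable {R}

/-- The universal property of `RB(G)`. -/
noncomputable def Burnside.lift {M : Type*} [AddCommGroup M] [Module R M] (f : FinGSet G → M)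
    (hiso : ∀ X Y, X.Equivalent Y → f X = f Y)
    (hadd : ∀ X Y, f (X.disjUnion Y) = f X + f Y) : Burnside R G →ₗ[R] M :=
  (burnsideRelations R G).liftQ (Finsupp.linearCombination R f) (by
    refine Submodule.span_le.2 ?_
    rintro r (⟨X, Y, h, rfl⟩ | ⟨X, Y, rfl⟩)
    · simp [hiso X Y h]
    · simp [hadd X Y])

theorem Burnside.lift_cls {M : Type*} [AddCommGroup M] [Module R M] (f : FinGSet G → M)
    (hiso : ∀ X Y, X.Equivalent Y → f X = f Y)
    (hadd : ∀ X Y, f (X.disjUnion Y) = f X + f Y) (X : FinGSet G) :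
    Burnside.lift (R := R) f hiso hadd (Burnside.cls R X) = f X := by
  unfold Burnside.lift Burnside.cls
  exact (Submodule.liftQ_apply _ _ _).trans (by simp)

variable (R)

theorem Burnside.cls_eq {X Y : FinGSet G} (h : X.Equivalent Y) :
    Burnside.cls R X = Burnside.cls R Y :=
  (Submodule.Quotient.eq _).2 (Submodule.subset_span (Or.inl ⟨X, Y, h, rfl⟩))

theorem Burnside.cls_disjUnion (X Y : FinGSet G) :
    Burnside.cls R (X.disjUnion Y) = Burnside.cls R X + Burnside.cls R Y :=
  (Submodule.Quotient.eq _).2 (Submodule.subset_span (Or.inr ⟨X, Y, rfl⟩))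

variable {H : Type u} [Group H]

theorem FinBiset.tensor_equivalent (U : FinBiset H G) {X Y : FinGSet G} (h : X.Equivalent Y) :
    (U.tensor X).Equivalent (U.tensor Y) := by
  obtain ⟨f, hf⟩ := h
  have hf' : ∀ (g : G) (y : Y.carrier), f.symm (g • y) = g • f.symm y := fun g y => by
    rw [Equiv.symm_apply_eq, hf, Equiv.apply_symm_apply]
  refine ⟨⟨Quotient.map (fun p => (p.1, f p.2)) ?_,
    Quotient.map (fun p => (p.1, f.symm p.2)) ?_, ?_, ?_⟩, ?_⟩
  · rintro p q ⟨g, rfl⟩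
    exact ⟨g, by simp [hf]⟩
  · rintro p q ⟨g, rfl⟩
    exact ⟨g, by simp [hf']⟩
  · rintro ⟨p⟩
    exact congrArg (Quotient.mk _) (by simp)
  · rintro ⟨p⟩
    exact congrArg (Quotient.mk _) (by simp)
  · rintro h ⟨p⟩
    rfl

theorem FinBiset.tensor_disjUnion (U : FinBiset H G) (X Y : FinGSet G) :
    (U.tensor (X.disjUnion Y)).Equivalent ((U.tensor X).disjUnion (U.tensor Y)) := by
  let F : (U.tensor (X.disjUnion Y)).carrier → ((U.tensor X).disjUnion (U.tensor Y)).carrier :=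
    Quotient.lift
      (fun p => Sum.elim (fun x => Sum.inl (Quotient.mk (U.tensorSetoid X) (p.1, x)))
        (fun y => Sum.inr (Quotient.mk (U.tensorSetoid Y) (p.1, y))) p.2) (by
      rintro ⟨u, x | y⟩ q ⟨g, rfl⟩
      · exact congrArg Sum.inl (Quotient.sound ⟨g, rfl⟩)
      · exact congrArg Sum.inr (Quotient.sound ⟨g, rfl⟩))
  let E : ((U.tensor X).disjUnion (U.tensor Y)).carrier → (U.tensor (X.disjUnion Y)).carrier :=
    Sum.elim
      (Quotient.map' (s₁ := U.tensorSetoid X) (s₂ := U.tensorSetoid (X.disjUnion Y))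
        (fun p => (p.1, Sum.inl p.2)) (by
          rintro p q ⟨g, rfl⟩
          exact ⟨g, rfl⟩))
      (Quotient.map' (s₁ := U.tensorSetoid Y) (s₂ := U.tensorSetoid (X.disjUnion Y))
        (fun p => (p.1, Sum.inr p.2)) (by
          rintro p q ⟨g, rfl⟩
          exact ⟨g, rfl⟩))
  refine ⟨⟨F, E, ?_, ?_⟩, ?_⟩
  · rintro ⟨u, x | y⟩ <;> rfl
  · rintro (⟨u, x⟩ | ⟨u, y⟩) <;> rfl
  · rintro h ⟨u, x | y⟩ <;> rfl

/-- The map `RB(U) : RB(G) → RB(H)`, `[X] ↦ [U ×_G X]`, for a finite `(H, G)`-biset `U`. -/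
noncomputable def Burnside.map (U : FinBiset H G) : Burnside R G →ₗ[R] Burnside R H :=
  Burnside.lift (fun X => Burnside.cls R (U.tensor X))
    (fun _ _ h => Burnside.cls_eq R (U.tensor_equivalent h))
    (fun X Y => by
      rw [← Burnside.cls_disjUnion]
      exact Burnside.cls_eq R (U.tensor_disjUnion X Y))

end Burnside

/-! ## The shifted Burnside functor -/

section Shifted

variable (𝔽 : Type v) [Field 𝔽] (K : Type u) [Group K]

/-- The evaluation `𝔽B_K(G) = 𝔽B(G × K)` of the shifted Burnside functor. -/
abbrev ShiftedBurnside (G : Type u) [Group G] : Type (max (u + 1) v) := Burnside 𝔽 (G × K)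

/-- The map `𝔽B_K(U) = 𝔽B(U × K)` attached to a finite `(H, G)`-biset `U`. -/
noncomputable def ShiftedBurnside.map [Finite K] {H G : Type u} [Group H] [Group G] (U : FinBiset H G) :
    ShiftedBurnside 𝔽 K G →ₗ[𝔽] ShiftedBurnside 𝔽 K H :=
  Burnside.map 𝔽 (U.prodGroup K)

variable {K}

/-- The `(G × H) × K`-set `X × Y`, for a `G × K`-set `X` and an `H × K`-set `Y`, with action
`((g, h), k) (x, y) = ((g, k) x, (h, k) y)`. -/
def FinGSet.shiftedProd {G H : Type u} [Group G] [Group H] (X : FinGSet (G × K))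
    (Y : FinGSet (H × K)) : FinGSet ((G × H) × K) where
  carrier := X.carrier × Y.carrier
  action :=
    { smul := fun a p => ((a.1.1, a.2) • p.1, (a.1.2, a.2) • p.2)
      one_smul := fun p => Prod.ext (one_smul (G × K) p.1) (one_smul (H × K) p.2)
      mul_smul := fun a b p => Prod.ext (mul_smul (a.1.1, a.2) (b.1.1, b.2) p.1)
        (mul_smul (a.1.2, a.2) (b.1.2, b.2) p.2) }

theorem FinGSet.shiftedProd_equivalent {G H : Type u} [Group G] [Group H]
    {X X' : FinGSet (G × K)} {Y Y' : FinGSet (H × K)} (hX : X.Equivalent X')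
    (hY : Y.Equivalent Y') : (X.shiftedProd Y).Equivalent (X'.shiftedProd Y') := by
  obtain ⟨e, he⟩ := hX
  obtain ⟨f, hf⟩ := hY
  exact ⟨Equiv.prodCongr e f, fun g p => Prod.ext (he _ p.1) (hf _ p.2)⟩

theorem FinGSet.disjUnion_shiftedProd {G H : Type u} [Group G] [Group H]
    (X X' : FinGSet (G × K)) (Y : FinGSet (H × K)) :
    ((X.disjUnion X').shiftedProd Y).Equivalent
      ((X.shiftedProd Y).disjUnion (X'.shiftedProd Y)) :=
  ⟨Equiv.sumProdDistrib _ _ _, by rintro g ⟨x | x, y⟩ <;> rfl⟩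

theorem FinGSet.shiftedProd_disjUnion {G H : Type u} [Group G] [Group H]
    (X : FinGSet (G × K)) (Y Y' : FinGSet (H × K)) :
    (X.shiftedProd (Y.disjUnion Y')).Equivalent
      ((X.shiftedProd Y).disjUnion (X.shiftedProd Y')) :=
  ⟨Equiv.prodSumDistrib _ _ _, by rintro g ⟨x, y | y⟩ <;> rfl⟩

theorem Burnside.hom_ext {R : Type v} [CommRing R] {G : Type u} [Group G] {M : Type*}
    [AddCommGroup M] [Module R M] {f g : Burnside R G →ₗ[R] M}
    (h : ∀ X, f (Burnside.cls R X) = g (Burnside.cls R X)) : f = g := by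
  refine Submodule.linearMap_qext _ (Finsupp.lhom_ext' fun X => LinearMap.ext_ring ?_)
  exact h X

/-- The product `𝔽B_K(G) × 𝔽B_K(H) → 𝔽B_K(G × H)` of the Green biset functor `𝔽B_K`: on classes
it sends `([X], [Y])` to the cartesian product `X × Y`, restricted from `(G × K) × (H × K)` to the
subgroup of elements `(g, k, h, k)`, identified with `(G × H) × K`. -/
noncomputable def ShiftedBurnside.prod {G H : Type u} [Group G] [Group H] :
    ShiftedBurnside 𝔽 K G →ₗ[𝔽] ShiftedBurnside 𝔽 K H →ₗ[𝔽] ShiftedBurnside 𝔽 K (G × H) :=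
  Burnside.lift
    (fun X => Burnside.lift (fun Y => Burnside.cls 𝔽 (X.shiftedProd Y))
      (fun _ _ h => Burnside.cls_eq 𝔽 (FinGSet.shiftedProd_equivalent ⟨Equiv.refl _, by simp⟩ h))
      (fun Y Y' => by
        rw [← Burnside.cls_disjUnion]
        exact Burnside.cls_eq 𝔽 (X.shiftedProd_disjUnion Y Y')))
    (fun X X' h => Burnside.hom_ext fun Y => by
      simp only [Burnside.lift_cls]
      exact Burnside.cls_eq 𝔽 (FinGSet.shiftedProd_equivalent h ⟨Equiv.refl _, by simp⟩))
    (fun X X' => Burnside.hom_ext fun Y => by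
      simp only [Burnside.lift_cls, LinearMap.add_apply]
      rw [← Burnside.cls_disjUnion]
      exact Burnside.cls_eq 𝔽 (X.disjUnion_shiftedProd X' Y))

variable (K) [Finite K]

/-- An ideal of the (commutative) Green biset functor `𝔽B_K`: a biset subfunctor `I` of `𝔽B_K`
which is an `𝔽B_K`-submodule, i.e. `𝔽B_K(G) × I(H)` is sent into `I(G × H)`.
Stability under all morphisms of the biset category is stability under finite bisets, since
these morphisms are linear combinations of finite bisets. -/
@[ext]
structure ShiftedIdeal where
  obj : ∀ (G : Type u) [Group G] [Finite G], Submodule 𝔽 (ShiftedBurnside 𝔽 K G)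
  map_mem : ∀ {H G : Type u} [Group H] [Finite H] [Group G] [Finite G] (U : FinBiset H G)
    {a : ShiftedBurnside 𝔽 K G}, a ∈ obj G → ShiftedBurnside.map 𝔽 K U a ∈ obj H
  prod_mem : ∀ {G H : Type u} [Group G] [Finite G] [Group H] [Finite H]
    (a : ShiftedBurnside 𝔽 K G) {b : ShiftedBurnside 𝔽 K H}, b ∈ obj H →
    ShiftedBurnside.prod 𝔽 a b ∈ obj (G × H)

variable {K}

/-- The ideal of `𝔽B_K` generated by an element `a` of `𝔽B_K(L)`: the intersection of all the
ideals that contain `a`. -/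
def ShiftedIdeal.generated {L : Type u} [Group L] [Finite L] (a : ShiftedBurnside 𝔽 K L) :
    ShiftedIdeal 𝔽 K where
  obj G _ _ :=
    { carrier := {x | ∀ I : ShiftedIdeal 𝔽 K, a ∈ I.obj L → x ∈ I.obj G}
      add_mem' := fun hx hy I hI => add_mem (hx I hI) (hy I hI)
      zero_mem' := fun I _ => zero_mem (I.obj G)
      smul_mem' := fun c _ hx I hI => (I.obj G).smul_mem c (hx I hI) }
  map_mem U _ hx I hI := I.map_mem U (hx I hI)
  prod_mem a' _ hb I hI := I.prod_mem a' (hb I hI)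

end Shifted

/-! ## Möbius functions and idempotents -/

section Moebius

open scoped Classical in
/-- The Möbius function `μ(X, L)` of the poset of subgroups of a finite group `G`. -/
noncomputable def subgroupMoebius {G : Type u} [Group G] [Finite G] (X L : Subgroup G) : ℤ :=
  letI : Fintype (Subgroup G) := Fintype.ofFinite _
  letI : LocallyFiniteOrder (Subgroup G) := Fintype.toLocallyFiniteOrder
  IncidenceAlgebra.mu ℤ X L

/-- The number `m_{L,N} = (1 / |L|) ∑_{X ≤ L, XN = L} |X| μ(X, L)`, for a normal subgroup `N` of a
finite group `L` (for `N` normal, `X ⊔ N` is `XN`). -/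
noncomputable def mNumber {L : Type u} [Group L] [Finite L] (N : Subgroup L) : ℚ :=
  (1 / (Nat.card L : ℚ)) *
    ∑ᶠ (X : Subgroup L) (_ : X ⊔ N = ⊤), (Nat.card X : ℚ) * (subgroupMoebius X ⊤ : ℚ)

/-- The idempotent
`e_L^G = (1 / |N_G(L)|) ∑_{X ≤ L} |X| μ(X, L) [G/X]` of the Burnside algebra `𝔽B(G)`. -/
noncomputable def burnsideIdempotent (𝔽 : Type v) [Field 𝔽] {G : Type u} [Group G] [Finite G]
    (L : Subgroup G) : Burnside 𝔽 G :=
  (1 / (Nat.card (Subgroup.normalizer (L : Set G)) : 𝔽)) •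
    ∑ᶠ (X : Subgroup G) (_ : X ≤ L),
      ((Nat.card X : 𝔽) * (subgroupMoebius X L : 𝔽)) • Burnside.cls 𝔽 (FinGSet.coset X)

end Moebius

/-! ## Groups over `K` -/

/-- A finite group over `K`: a pair `(L, φ)` with `L` a finite group and `φ : L → K` a
group homomorphism. -/
structure GrpOver (K : Type u) [Group K] where
  carrier : Type u
  [group : Group carrier]
  [finite : Finite carrier]
  hom : carrier →* K

attribute [instance] GrpOver.group GrpOver.finite

namespace GrpOver

variable {K : Type u} [Group K]

/-- A morphism `(L, φ) → (L', φ')`: a group homomorphism `f : L → L'` such that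
`i ∘ φ = φ' ∘ f` for some inner automorphism `i` of `K`. -/
@[ext]
structure Hom (X Y : GrpOver K) where
  toMonoidHom : X.carrier →* Y.carrier
  comm : ∃ k : K, ∀ l, k * X.hom l * k⁻¹ = Y.hom (toMonoidHom l)

/-- The category of finite groups over `K`. -/
instance : Category (GrpOver K) where
  Hom := Hom
  id X := ⟨MonoidHom.id X.carrier, 1, by simp⟩
  comp f g := ⟨g.toMonoidHom.comp f.toMonoidHom, by
    obtain ⟨a, ha⟩ := f.comm
    obtain ⟨b, hb⟩ := g.comm
    exact ⟨b * a, fun l => by simp [← hb, ← ha, mul_assoc]⟩⟩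

/-- `X ↠ Y`, i.e. `Y` is a quotient of `X`: there is a surjective morphism `X → Y`. -/
def SurjectsOnto (X Y : GrpOver K) : Prop :=
  ∃ f : X ⟶ Y, Function.Surjective (Hom.toMonoidHom f)

/-- The group `(L/Q, φ/Q)` over `K`, for a normal subgroup `Q` of `L` contained in `Ker φ`. -/
def quotient (X : GrpOver K) (Q : Subgroup X.carrier) [Q.Normal] (hQ : Q ≤ X.hom.ker) :
    GrpOver K where
  carrier := X.carrier ⧸ Q
  hom := QuotientGroup.lift Q X.hom hQ

/-- `(L, φ)` is a `B_K`-group: `m_{L,N} = 0` for every non-trivial normal subgroup `N` of `L`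
contained in `Ker φ`. -/
def IsBGroup (X : GrpOver K) : Prop :=
  ∀ N : Subgroup X.carrier, N.Normal → N ≤ X.hom.ker → N ≠ ⊥ → mNumber N = 0

/-- `Q` is a normal subgroup of `L` contained in `Ker φ`, and maximal such that `m_{L,Q} ≠ 0`. -/
def IsBetaKernel (X : GrpOver K) (Q : Subgroup X.carrier) : Prop :=
  Maximal (fun N : Subgroup X.carrier => N.Normal ∧ N ≤ X.hom.ker ∧ mNumber N ≠ 0) Q

/-- The group `β_K(L, φ) = (L/Q, φ/Q)` over `K`, formed with a given choice of a normal
subgroup `Q` of `L` contained in `Ker φ` and maximal such that `m_{L,Q} ≠ 0`. -/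
def beta (X : GrpOver K) (Q : Subgroup X.carrier) (hQ : X.IsBetaKernel Q) : GrpOver K :=
  haveI : Q.Normal := hQ.prop.1
  X.quotient Q hQ.prop.2.1

/-- The ideal `𝖾_{L,φ}` of `𝔽B_K`, generated by the idempotent `e_{L_φ}^{L × K}` of `𝔽B_K(L)`,
where `L_φ` is the graph of `φ`. -/
noncomputable def ideal [Finite K] (𝔽 : Type v) [Field 𝔽] (X : GrpOver K) : ShiftedIdeal 𝔽 K :=
  ShiftedIdeal.generated 𝔽 (L := X.carrier) (burnsideIdempotent 𝔽 X.hom.graph)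

end GrpOver

/-! ## Möbius functions of subgroup lattices -/

section MoebiusLattice

/-! Everything rests on one identity, `sum_subgroupMoebius_smul`. For a surjection `f : L → P`, the
function `μ(·, L)` on subgroups of `L` is the sum of `μ(X, L) μ(Y, P)` times the indicator of `X ∩
f⁻¹(Y)`, over all `Y ≤ P` and all `X ≤ L` with `f(X) = P`. Since `|X ∩ f⁻¹(Y)| |P| = |X| |Y|`,
weighted sums over `L` break into weighted sums over `P`.

Consequences for the numbers `m`: they are multiplicative (`mNumber_comap`), so maximality of `Q`
makes `L/Q` a `B_K`-group. If `m_{L,Q} ≠ 0`, some `X` has `f(X) = P`, `XQ = L` and `m_{P, f(X ∩ Q)}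
≠ 0`. When `P` is a `B_K`-group this forces `f(X ∩ Q) = 1`, so `f` restricted to `X` factors through
`X/(X ∩ Q) ≅ L/Q`. This is the universal property. Uniqueness follows, since finite groups that
surject onto each other are isomorphic.

Consequences for ideals: deflation from `L` to `L/Q` multiplies the idempotent sum by a nonzero
multiple of `m_{L,Q}`. Conversely, the sum for `L` is a combination of the sum for `L/Q` inflated to
subgroups `X` with `XQ = L` and induced to `L`. -/

theorem IncidenceAlgebra.mu_of_orderEmbedding {α β : Type*} [PartialOrder α] [PartialOrder β]
    [LocallyFiniteOrder α] [LocallyFiniteOrder β] [DecidableEq α] [DecidableEq β]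
    (e : α ↪o β) {b : α} (he : ∀ a z, e a ≤ z → z ≤ e b → z ∈ Set.range e) (a : α) :
    mu ℤ (e a) (e b) = mu ℤ a b := by
  classical
  have hmap : ∀ a, Finset.Ioc (e a) (e b) = (Finset.Ioc a b).map e.toEmbedding := by
    intro a
    ext z
    simp only [Finset.mem_Ioc, Finset.mem_map, RelEmbedding.coe_toEmbedding]
    constructor
    · rintro ⟨h₁, h₂⟩
      obtain ⟨c, rfl⟩ := he a z h₁.le h₂
      exact ⟨c, ⟨e.lt_iff_lt.1 h₁, e.le_iff_le.1 h₂⟩, rfl⟩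
    · rintro ⟨c, ⟨h₁, h₂⟩, rfl⟩
      exact ⟨e.lt_iff_lt.2 h₁, e.le_iff_le.2 h₂⟩
  -- The recursion writes `μ(a, b)` through `μ(c, b)` with `a < c ≤ b`; the interval above `c` is
  -- smaller and corresponds to its image under `e`.
  induction hn : (Finset.Ioc a b).card using Nat.strong_induction_on generalizing a with
  | _ n ih =>
    by_cases hab : a = b
    · simp [hab]
    · rw [mu_eq_neg_sum_Ioc_of_ne hab, mu_eq_neg_sum_Ioc_of_ne (fun h => hab (e.injective h)),
        hmap, Finset.sum_map]
      congr 1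
      refine Finset.sum_congr rfl fun c hc => ih _ ?_ c rfl
      rw [← hn]
      refine Finset.card_lt_card ((Finset.ssubset_iff_of_subset ?_).2 ⟨c, hc, by simp⟩)
      exact Finset.Ioc_subset_Ioc_left (Finset.mem_Ioc.1 hc).1.le

theorem Subgroup.map_eq_top_iff_sup_ker {L P : Type*} [Group L] [Group P] {f : L →* P}
    (hf : Function.Surjective f) {X : Subgroup L} : X.map f = ⊤ ↔ X ⊔ f.ker = ⊤ := by
  rw [← Subgroup.comap_map_eq]
  constructor
  · intro h
    rw [h, Subgroup.comap_top]
  · intro h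
    rw [← Subgroup.map_comap_eq_self_of_surjective hf (X.map f), h,
      Subgroup.map_top_of_surjective f hf]

variable {L P : Type*} [Group L] [Group P] [Finite L] [Finite P]

open scoped Classical in
-- Möbius inversion from the top: the sums over upper sets determine a function, and `μ(·, L)` is
-- the one whose sums form the indicator of `L`.
theorem subgroupMoebius_unique [Fintype (Subgroup L)] (f : Subgroup L → ℤ)
    (hf : ∀ W, (∑ Z, if W ≤ Z then f Z else 0) = if W = ⊤ then 1 else 0) (X : Subgroup L) :
    f X = subgroupMoebius X ⊤ := by
  let _ : LocallyFiniteOrder (Subgroup L) := Fintype.toLocallyFiniteOrder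
  have h := IncidenceAlgebra.moebius_inversion_top (𝕜 := ℤ) f
    (fun W => if W = ⊤ then 1 else 0) (fun W => by
      rw [← hf W, ← Finset.sum_filter]
      exact Finset.sum_congr (by ext; simp) fun _ _ => rfl) X
  rw [h]
  unfold subgroupMoebius
  simp only [mul_ite, mul_one, mul_zero, Finset.sum_ite_eq', Finset.mem_Ici, le_top, if_true]
  -- `subgroupMoebius` carries its own order and decidability instances; they agree with the local
  -- ones because such instances are unique.
  congr!

open scoped Classical in
theorem sum_subgroupMoebius [Fintype (Subgroup L)] (W : Subgroup L) :
    (∑ Z, if W ≤ Z then subgroupMoebius Z ⊤ else 0) = if W = ⊤ then 1 else 0 := by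
  let _ : LocallyFiniteOrder (Subgroup L) := Fintype.toLocallyFiniteOrder
  rw [← IncidenceAlgebra.sum_Icc_mu_left (𝕜 := ℤ) W ⊤, ← Finset.sum_filter]
  refine Finset.sum_congr (by ext; simp) fun _ _ => ?_
  unfold subgroupMoebius
  congr!

/-- Every subgroup of the range of `g` is an image, so the lattice below the range is that of `L`.
It is applied to the embedding of `L` as the graph of `φ`. -/
theorem subgroupMoebius_map {g : L →* P} (hg : Function.Injective g) (X : Subgroup L) :
    subgroupMoebius (X.map g) g.range = subgroupMoebius X ⊤ := by
  classical
  unfold subgroupMoebius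
  let _ : Fintype (Subgroup L) := Fintype.ofFinite _
  let _ : LocallyFiniteOrder (Subgroup L) := Fintype.toLocallyFiniteOrder
  let _ : Fintype (Subgroup P) := Fintype.ofFinite _
  let _ : LocallyFiniteOrder (Subgroup P) := Fintype.toLocallyFiniteOrder
  have h := IncidenceAlgebra.mu_of_orderEmbedding
    (OrderEmbedding.ofMapLEIff (Subgroup.map g) fun _ _ => Subgroup.map_le_map_iff_of_injective hg)
    (b := ⊤) (fun a z _ hz => ⟨z.comap g, Subgroup.map_comap_eq_self (by
      simpa [MonoidHom.range_eq_map] using hz)⟩) X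
  simp only [OrderEmbedding.coe_ofMapLEIff] at h
  rw [← h, ← MonoidHom.range_eq_map]

open scoped Classical in
/-- The Möbius function of the subgroup lattice of `L` in terms of that of a quotient of `L`. -/
theorem sum_subgroupMoebius_smul [Fintype (Subgroup L)] [Fintype (Subgroup P)] {f : L →* P}
    (hf : Function.Surjective f) {M : Type*} [AddCommGroup M] (w : Subgroup L → M) :
    ∑ Z, subgroupMoebius Z ⊤ • w Z = ∑ X : Subgroup L, ∑ Y : Subgroup P,
      ((if X.map f = ⊤ then subgroupMoebius X ⊤ else 0) * subgroupMoebius Y ⊤) •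
        w (X ⊓ Y.comap f) := by
  set a : Subgroup L → ℤ := fun X => if X.map f = ⊤ then subgroupMoebius X ⊤ else 0 with ha
  have key : ∀ Z : Subgroup L, (∑ X : Subgroup L, ∑ Y : Subgroup P,
      if X ⊓ Y.comap f = Z then a X * subgroupMoebius Y ⊤ else 0) = subgroupMoebius Z ⊤ := by
    intro Z
    refine subgroupMoebius_unique (fun Z => ∑ X : Subgroup L, ∑ Y : Subgroup P,
      if X ⊓ Y.comap f = Z then a X * subgroupMoebius Y ⊤ else 0) (fun W => ?_) Z
    -- `W ≤ X ∩ f⁻¹(Y)` means `W ≤ X` and `f(W) ≤ Y`, so the double sum factors.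
    have h₁ : (∑ Z : Subgroup L, if W ≤ Z then ∑ X : Subgroup L, ∑ Y : Subgroup P,
        (if X ⊓ Y.comap f = Z then a X * subgroupMoebius Y ⊤ else 0) else 0) =
        (∑ X : Subgroup L, if W ≤ X then a X else 0) *
          ∑ Y : Subgroup P, if W.map f ≤ Y then subgroupMoebius Y ⊤ else 0 := by
      rw [Finset.sum_mul_sum, ← Finset.sum_filter, Finset.sum_comm]
      refine Finset.sum_congr rfl fun X _ => ?_
      rw [Finset.sum_comm]
      refine Finset.sum_congr rfl fun Y _ => ?_
      simp only [Finset.sum_ite_eq, Finset.mem_filter, Finset.mem_univ, true_and, le_inf_iff,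
        Subgroup.map_le_iff_le_comap]
      by_cases h : W ≤ X <;> by_cases h' : W ≤ Y.comap f <;> simp [h, h']
    rw [h₁, sum_subgroupMoebius]
    -- The factor over `P` vanishes unless `f(W) = P`; in that case every `X ≥ W` already satisfies
    -- `f(X) = P`, and the restriction on `X` disappears.
    by_cases hW : W.map f = ⊤
    · rw [if_pos hW, mul_one, ← sum_subgroupMoebius]
      refine Finset.sum_congr rfl fun X _ => ?_
      by_cases hX : W ≤ X
      · simp [ha, hX, top_le_iff.1 (hW ▸ Subgroup.map_mono (f := f) hX)]
      · simp [hX]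
    · rw [if_neg hW, mul_zero, if_neg]
      rintro rfl
      exact hW (Subgroup.map_top_of_surjective f hf)
  refine (Finset.sum_congr rfl fun Z _ => congrArg (· • w Z) (key Z).symm).trans ?_
  simp_rw [Finset.sum_smul]
  rw [Finset.sum_comm]
  refine Finset.sum_congr rfl fun X _ => ?_
  rw [Finset.sum_comm]
  refine Finset.sum_congr rfl fun Y _ => ?_
  simp [ite_smul, ha]

end MoebiusLattice

/-! ## The numbers `m_{L,N}` -/

section MNumber

theorem Subgroup.map_inf_comap_of_map_eq_top {L P : Type*} [Group L] [Group P] {f : L →* P}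
    {X : Subgroup L} (hX : X.map f = ⊤) (Y : Subgroup P) : (X ⊓ Y.comap f).map f = Y := by
  refine le_antisymm (Subgroup.map_le_iff_le_comap.2 inf_le_right) fun y hy => ?_
  obtain ⟨x, hx, rfl⟩ : y ∈ X.map f := hX ▸ Subgroup.mem_top y
  exact ⟨x, ⟨hx, hy⟩, rfl⟩

/-- `X ∩ f⁻¹(Y)` is the preimage of `Y` under the surjection `X → P`, hence has index `|P : Y|` in
`X`. -/
theorem Subgroup.card_inf_comap_mul_card {L P : Type*} [Group L] [Group P] {f : L →* P}
    {X : Subgroup L} (hX : X.map f = ⊤) (Y : Subgroup P) :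
    Nat.card (X ⊓ Y.comap f : Subgroup L) * Nat.card P = Nat.card X * Nat.card Y := by
  have hg : Function.Surjective (f.comp X.subtype) := fun y => by
    obtain ⟨x, hx, rfl⟩ : y ∈ X.map f := hX ▸ Subgroup.mem_top y
    exact ⟨⟨x, hx⟩, rfl⟩
  have h₁ : Nat.card (X ⊓ Y.comap f : Subgroup L) = Nat.card (Y.comap (f.comp X.subtype)) := by
    change _ = Nat.card ((Y.comap f).subgroupOf X)
    rw [← Subgroup.inf_subgroupOf_left]
    exact (Nat.card_congr (Subgroup.subgroupOfEquivOfLe inf_le_left).toEquiv).symm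
  rw [h₁, ← Y.card_mul_index, ← (Y.comap (f.comp X.subtype)).card_mul_index,
    Y.index_comap_of_surjective hg]
  ring

/-- If `x = zq` with `x, z ∈ X`, then `q ∈ X ∩ Q`; conversely `f(x) = y f(q)` puts `xq⁻¹` in `X ∩
f⁻¹(Y)`. The condition on subgroups that defines `m_{L,Q}` thus becomes the one that defines `m_{P,
f(X ∩ Q)}`. -/
theorem Subgroup.inf_comap_sup_eq_top_iff {L P : Type*} [Group L] [Group P] {f : L →* P}
    {X : Subgroup L} (hX : X.map f = ⊤) {Q : Subgroup L} [Q.Normal] (hQ : X ⊔ Q = ⊤)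
    (Y : Subgroup P) : X ⊓ Y.comap f ⊔ Q = ⊤ ↔ Y ⊔ (X ⊓ Q).map f = ⊤ := by
  have hN : ((X ⊓ Q).map f).Normal := by
    refine ⟨?_⟩
    rintro _ ⟨q, ⟨hqX, hq⟩, rfl⟩ g
    obtain ⟨x, hx, rfl⟩ : g ∈ X.map f := hX ▸ Subgroup.mem_top g
    exact ⟨x * q * x⁻¹, ⟨X.mul_mem (X.mul_mem hx hqX) (X.inv_mem hx),
      Subgroup.Normal.conj_mem inferInstance q hq x⟩, by simp⟩
  constructor
  · refine fun h => top_le_iff.1 fun y _ => ?_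
    obtain ⟨x, hx, rfl⟩ : y ∈ X.map f := hX ▸ Subgroup.mem_top y
    obtain ⟨z, ⟨hzX, hzY⟩, q, hq, rfl⟩ := Subgroup.mem_sup_of_normal_right.1
      (h ▸ Subgroup.mem_top x : x ∈ X ⊓ Y.comap f ⊔ Q)
    rw [map_mul]
    exact Subgroup.mul_mem_sup hzY ⟨q, ⟨(X.mul_mem_cancel_left hzX).1 hx, hq⟩, rfl⟩
  · refine fun h => top_le_iff.1 (hQ ▸ sup_le (fun x hx => ?_) le_sup_right)
    obtain ⟨y, hy, _, ⟨q, ⟨hqX, hq⟩, rfl⟩, h'⟩ := Subgroup.mem_sup_of_normal_right.1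
      (h ▸ Subgroup.mem_top (f x) : f x ∈ Y ⊔ (X ⊓ Q).map f)
    rw [← inv_mul_cancel_right x q, ← div_inv_eq_mul, div_eq_mul_inv, inv_inv]
    refine Subgroup.mul_mem_sup ⟨X.mul_mem hx (X.inv_mem hqX), ?_⟩ hq
    change f (x * q⁻¹) ∈ Y
    rwa [map_mul, map_inv, ← h', mul_inv_cancel_right]

variable {L P : Type*} [Group L] [Group P] [Finite L] [Finite P]

open scoped Classical in
theorem card_mul_mNumber [Fintype (Subgroup L)] (N : Subgroup L) :
    (Nat.card L : ℚ) * mNumber N =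
      ((∑ X : Subgroup L, if X ⊔ N = ⊤ then subgroupMoebius X ⊤ * (Nat.card X : ℤ) else 0 : ℤ) :
        ℚ) := by
  have h : (Nat.card L : ℚ) ≠ 0 := Nat.cast_ne_zero.2 Nat.card_pos.ne'
  rw [mNumber, ← mul_assoc, mul_one_div_cancel h, one_mul, finsum_eq_sum_of_fintype]
  push_cast
  refine Finset.sum_congr rfl fun X _ => ?_
  by_cases hX : X ⊔ N = ⊤ <;> simp [hX, mul_comm]

theorem mNumber_bot : mNumber (⊥ : Subgroup L) = 1 := by
  classical
  let _ : Fintype (Subgroup L) := Fintype.ofFinite _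
  have h : (Nat.card L : ℚ) ≠ 0 := Nat.cast_ne_zero.2 Nat.card_pos.ne'
  have hμ := sum_subgroupMoebius (⊤ : Subgroup L)
  simp only [top_le_iff, Finset.sum_ite_eq', Finset.mem_univ, if_true] at hμ
  refine mul_left_cancel₀ h ?_
  rw [card_mul_mNumber]
  simp [hμ]

/-- For `f` surjective, the sum of `|Z| μ(Z, L) v(f(Z))` over the subgroups `Z` of `L` is, up to the
factor `m_{L, Ker f}`, the sum of `|Y| μ(Y, P) v(Y)` over the subgroups `Y` of `P`. -/
theorem sum_card_smul_map [Fintype (Subgroup L)] [Fintype (Subgroup P)] {f : L →* P}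
    (hf : Function.Surjective f) {M : Type*} [AddCommGroup M] [Module ℚ M] (v : Subgroup P → M) :
    (Nat.card P : ℚ) • ∑ Z : Subgroup L, (subgroupMoebius Z ⊤ * (Nat.card Z : ℤ)) • v (Z.map f) =
      (Nat.card L * mNumber f.ker) •
        ∑ Y : Subgroup P, (subgroupMoebius Y ⊤ * (Nat.card Y : ℤ)) • v Y := by
  classical
  simp_rw [mul_smul (subgroupMoebius _ _)]
  rw [sum_subgroupMoebius_smul hf, card_mul_mNumber, Int.cast_smul_eq_zsmul, Finset.sum_smul_sum,
    Finset.smul_sum]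
  refine Finset.sum_congr rfl fun X _ => ?_
  rw [Finset.smul_sum]
  refine Finset.sum_congr rfl fun Y _ => ?_
  simp_rw [← Subgroup.map_eq_top_iff_sup_ker hf]
  -- As `f(X ∩ f⁻¹(Y)) = Y`, the vector depends on `Y` only, and the sum over `X` separates into
  -- `|L| m_{L, Ker f}`.
  by_cases hX : X.map f = ⊤
  · have h := Subgroup.card_inf_comap_mul_card hX Y
    rw [if_pos hX, if_pos hX, Subgroup.map_inf_comap_of_map_eq_top hX, Nat.cast_smul_eq_nsmul,
      ← natCast_zsmul, smul_smul, smul_smul, smul_smul, smul_smul]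
    congr 1
    have h' : (Nat.card (X ⊓ Y.comap f : Subgroup L) : ℤ) * Nat.card P = Nat.card X * Nat.card Y :=
      mod_cast h
    linear_combination (subgroupMoebius X ⊤ * subgroupMoebius Y ⊤) * h'
  · simp [hX]

/-- Apply `sum_card_smul_map` to the indicator of `YN = P`. -/
theorem mNumber_comap {f : L →* P} (hf : Function.Surjective f) (N : Subgroup P) :
    mNumber (N.comap f) = mNumber f.ker * mNumber N := by
  classical
  let _ : Fintype (Subgroup L) := Fintype.ofFinite _
  let _ : Fintype (Subgroup P) := Fintype.ofFinite _
  have hL : (Nat.card L : ℚ) ≠ 0 := Nat.cast_ne_zero.2 Nat.card_pos.ne'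
  have hP : (Nat.card P : ℚ) ≠ 0 := Nat.cast_ne_zero.2 Nat.card_pos.ne'
  have h := sum_card_smul_map hf (fun Y => if Y ⊔ N = ⊤ then (1 : ℚ) else 0)
  have h₁ : ∀ Z : Subgroup L, Z.map f ⊔ N = ⊤ ↔ Z ⊔ N.comap f = ⊤ := by
    intro Z
    rw [← Subgroup.map_comap_eq_self_of_surjective hf N, ← Subgroup.map_sup,
      Subgroup.map_eq_top_iff_sup_ker hf, Subgroup.map_comap_eq_self_of_surjective hf N, sup_assoc,
      sup_eq_left.2 (Subgroup.ker_le_comap f N)]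
  have h₂ := card_mul_mNumber (N.comap f)
  have h₃ := card_mul_mNumber N
  simp only [zsmul_eq_mul, mul_ite, mul_one, mul_zero, h₁, smul_eq_mul] at h
  push_cast at h h₂ h₃
  rw [← h₂, ← h₃] at h
  refine mul_left_cancel₀ (mul_ne_zero hL hP) ?_
  linear_combination h

/-- If `m_{L,Q} ≠ 0`, then for each quotient `f : L → P` there is a subgroup `X` with
`f(X) = P`, `XQ = L` and `m_{P, f(X ∩ Q)} ≠ 0`. -/
theorem exists_mNumber_map_ne_zero {f : L →* P} (hf : Function.Surjective f) {Q : Subgroup L}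
    [Q.Normal] (hQ : mNumber Q ≠ 0) : ∃ X : Subgroup L, X.map f = ⊤ ∧ X ⊔ Q = ⊤ ∧
      mNumber ((X ⊓ Q).map f) ≠ 0 := by
  classical
  by_contra! hcon
  let _ : Fintype (Subgroup L) := Fintype.ofFinite _
  let _ : Fintype (Subgroup P) := Fintype.ofFinite _
  have hL : (Nat.card L : ℚ) ≠ 0 := Nat.cast_ne_zero.2 Nat.card_pos.ne'
  have hP : (Nat.card P : ℤ) ≠ 0 := Nat.cast_ne_zero.2 Nat.card_pos.ne'
  have h := card_mul_mNumber Q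
  replace hQ := mul_ne_zero hL hQ
  rw [h, Int.cast_ne_zero] at hQ
  refine hQ ((mul_eq_zero.1 (?_ : _ * (Nat.card P : ℤ) = 0)).resolve_right hP)
  have h₁ := sum_subgroupMoebius_smul hf
    (fun Z => if Z ⊔ Q = ⊤ then (Nat.card Z : ℤ) else 0)
  simp only [smul_eq_mul, mul_ite, mul_zero] at h₁
  rw [h₁, Finset.sum_mul]
  refine Finset.sum_eq_zero fun X _ => ?_
  -- After multiplication by `|P|`, the contribution of `X` is `μ(X, L) |X|` times `|P| m_{P, f(X ∩
  -- Q)}`, which the assumption kills. If `XQ ≠ L`, no subgroup of `X` supplements `Q`.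
  by_cases hX : X.map f = ⊤
  · by_cases hXQ : X ⊔ Q = ⊤
    · have h₂ := card_mul_mNumber ((X ⊓ Q).map f)
      rw [hcon X hX hXQ, mul_zero, eq_comm, Int.cast_eq_zero] at h₂
      refine Eq.trans ?_ ((congrArg (subgroupMoebius X ⊤ * Nat.card X * ·) h₂).trans (mul_zero _))
      rw [Finset.sum_mul, Finset.mul_sum]
      refine Finset.sum_congr rfl fun Y _ => ?_
      rw [if_pos hX]
      by_cases hY : Y ⊔ (X ⊓ Q).map f = ⊤
      · rw [if_pos hY, if_pos ((Subgroup.inf_comap_sup_eq_top_iff hX hXQ Y).2 hY)]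
        have h' : (Nat.card (X ⊓ Y.comap f : Subgroup L) : ℤ) * Nat.card P =
          Nat.card X * Nat.card Y := mod_cast Subgroup.card_inf_comap_mul_card hX Y
        linear_combination (subgroupMoebius X ⊤ * subgroupMoebius Y ⊤) * h'
      · rw [if_neg hY, if_neg fun h => hY ((Subgroup.inf_comap_sup_eq_top_iff hX hXQ Y).1 h)]
        simp
    · rw [Finset.sum_eq_zero, zero_mul]
      refine fun Y _ => if_neg fun h' => hXQ ?_
      exact top_le_iff.1 (h'.ge.trans (sup_le_sup_right inf_le_left Q))
  · simp [hX]

end MNumber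

/-! ## The group `β_K(L, φ)` -/

namespace GrpOver

variable {K : Type u} [Group K]

theorem surjectsOnto_quotient (X : GrpOver K) (Q : Subgroup X.carrier) [Q.Normal]
    (hQ : Q ≤ X.hom.ker) : X.SurjectsOnto (X.quotient Q hQ) :=
  ⟨⟨QuotientGroup.mk' Q, 1, fun l => by
    rw [one_mul, inv_one, mul_one]
    exact (QuotientGroup.lift_mk' Q hQ l).symm⟩, QuotientGroup.mk'_surjective Q⟩

theorem nonempty_iso {X Y : GrpOver K} (hXY : X.SurjectsOnto Y) (hYX : Y.SurjectsOnto X) :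
    Nonempty (X ≅ Y) := by
  obtain ⟨⟨f, k, hk⟩, hf⟩ := hXY
  obtain ⟨⟨g, _⟩, hg⟩ := hYX
  have hf' : Function.Bijective f := (Nat.bijective_iff_surjective_and_card f).2
    ⟨hf, le_antisymm (Nat.card_le_card_of_surjective g hg) (Nat.card_le_card_of_surjective f hf)⟩
  let e := MulEquiv.ofBijective f hf'
  refine ⟨⟨⟨f, k, hk⟩, ⟨e.symm.toMonoidHom, k⁻¹, fun l => ?_⟩, ?_, ?_⟩⟩
  · obtain ⟨x, rfl⟩ := e.surjective l
    have : Y.hom (e x) = k * X.hom x * k⁻¹ := (hk x).symm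
    simp [this, mul_assoc]
  · exact Hom.ext (MonoidHom.ext fun x => e.symm_apply_apply x)
  · exact Hom.ext (MonoidHom.ext fun x => e.apply_symm_apply x)

variable {X : GrpOver K} {Q : Subgroup X.carrier}

theorem exists_isBetaKernel (X : GrpOver K) : ∃ Q : Subgroup X.carrier, X.IsBetaKernel Q :=
  (Set.toFinite {N : Subgroup X.carrier | N.Normal ∧ N ≤ X.hom.ker ∧ mNumber N ≠ 0}).exists_maximal
    ⟨⊥, inferInstance, bot_le, by simp [mNumber_bot]⟩

/-- A nontrivial `N` with nonzero `m` would pull back to a subgroup strictly above `Q`, whose `m` is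
a product of two nonzero numbers. -/
theorem isBGroup_beta (hQ : X.IsBetaKernel Q) : (X.beta Q hQ).IsBGroup := by
  have := hQ.prop.1
  intro N hN hNK hN1
  by_contra hm
  let f : X.carrier →* (X.beta Q hQ).carrier := QuotientGroup.mk' Q
  have hf : Function.Surjective f := QuotientGroup.mk'_surjective Q
  have hker : f.ker = Q := QuotientGroup.ker_mk' Q
  have hle : Q ≤ N.comap f := hker.ge.trans (Subgroup.ker_le_comap f N)
  have h : N.comap f ≤ Q := hQ.le_of_ge ⟨hN.comap f, fun x hx => hNK hx, by
    rw [mNumber_comap hf, hker]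
    exact mul_ne_zero hQ.prop.2.2 hm⟩ hle
  refine hN1 (le_bot_iff.1 fun y hy => ?_)
  obtain ⟨x, rfl⟩ := hf y
  exact MonoidHom.mem_ker.1 (hker.ge (h hy))

/-- `Q` need not lie in `Ker f`, so `f` itself need not descend to `L/Q`. Its restriction to a
suitable supplement `Y` of `Q` does. -/
theorem surjectsOnto_of_mNumber_ne_zero [Q.Normal] (hQ : Q ≤ X.hom.ker) (hm : mNumber Q ≠ 0)
    {P : GrpOver K} (hP : P.IsBGroup) (hXP : X.SurjectsOnto P) :
    (X.quotient Q hQ).SurjectsOnto P := by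
  obtain ⟨⟨f, k, hk⟩, hf⟩ := hXP
  obtain ⟨Y, hYf, hYQ, hYm⟩ := exists_mNumber_map_ne_zero hf hm
  have hN : ((Y ⊓ Q).map f).Normal := by
    refine ⟨?_⟩
    rintro _ ⟨q, ⟨hqX, hq⟩, rfl⟩ g
    obtain ⟨x, hx, rfl⟩ : g ∈ Y.map f := hYf ▸ Subgroup.mem_top g
    exact ⟨x * q * x⁻¹, ⟨Y.mul_mem (Y.mul_mem hx hqX) (Y.inv_mem hx),
      Subgroup.Normal.conj_mem inferInstance q hq x⟩, by simp⟩
  have hbot : (Y ⊓ Q).map f = ⊥ := by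
    by_contra hne
    -- `ψ ∘ f` is conjugate to `φ`, which is trivial on `Q`; hence `f(Y ∩ Q) ≤ Ker ψ`.
    refine hYm (hP _ hN ?_ hne)
    rintro _ ⟨q, ⟨_, hq⟩, rfl⟩
    rw [MonoidHom.mem_ker, ← hk, (MonoidHom.mem_ker).1 (hQ hq)]
    simp
  let r : Y →* X.carrier ⧸ Q := (QuotientGroup.mk' Q).comp Y.subtype
  have hr : Function.Surjective r := by
    intro z
    obtain ⟨x, rfl⟩ := QuotientGroup.mk'_surjective Q z
    obtain ⟨y, hy, q, hq, rfl⟩ := Subgroup.mem_sup_of_normal_right.1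
      (hYQ ▸ Subgroup.mem_top x : x ∈ Y ⊔ Q)
    exact ⟨⟨y, hy⟩, by simp [r, (QuotientGroup.eq_one_iff q).2 hq]⟩
  let s : Y →* P.carrier := f.comp Y.subtype
  have hrs : r.ker ≤ s.ker := fun y hy => by
    have : f y ∈ (Y ⊓ Q).map f := ⟨y, ⟨y.2, (QuotientGroup.eq_one_iff _).1 hy⟩, rfl⟩
    rwa [hbot, Subgroup.mem_bot] at this
  let g : X.carrier ⧸ Q →* P.carrier := r.liftOfSurjective hr ⟨s, hrs⟩
  have hg : ∀ y, g (r y) = s y := r.liftOfRightInverse_comp_apply _ _ ⟨s, hrs⟩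
  refine ⟨⟨g, k, fun z => ?_⟩, fun p => ?_⟩
  · obtain ⟨y, rfl⟩ := hr z
    exact (hk y).trans (congrArg P.hom (hg y).symm)
  · obtain ⟨y, hy, rfl⟩ : p ∈ Y.map f := hYf ▸ Subgroup.mem_top p
    exact ⟨r ⟨y, hy⟩, hg _⟩

end GrpOver

/-! ## Induction and inflation along group homomorphisms -/

section Bisets

theorem FinGSet.equivalent_coset {G : Type u} [Group G] [Finite G] (Z : FinGSet G) (z : Z.carrier)
    (htrans : ∀ y, ∃ g : G, g • z = y) {S : Subgroup G} (hstab : ∀ g : G, g • z = z ↔ g ∈ S) :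
    Z.Equivalent (FinGSet.coset S) := by
  obtain rfl : MulAction.stabilizer G z = S := Subgroup.ext hstab
  let e : (G ⧸ MulAction.stabilizer G z) ≃ Z.carrier :=
    Equiv.ofBijective (MulAction.ofQuotientStabilizer G z)
      ⟨MulAction.injective_ofQuotientStabilizer G z, fun y => by
        obtain ⟨g, hg⟩ := htrans y
        exact ⟨(g : G ⧸ MulAction.stabilizer G z), hg⟩⟩
  refine ⟨e.symm, fun g x => ?_⟩
  refine (Equiv.symm_apply_eq e).2 ?_
  refine Eq.trans ?_ (MulAction.ofQuotientStabilizer_smul G z g (e.symm x)).symm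
  exact congrArg (g • ·) (e.apply_symm_apply x).symm

variable {G H : Type u} [Group G] [Group H]

theorem Burnside.map_cls (R : Type v) [CommRing R] (U : FinBiset H G) (X : FinGSet G) :
    Burnside.map R U (Burnside.cls R X) = Burnside.cls R (U.tensor X) := by
  rw [Burnside.map, Burnside.lift_cls]

/-- The `(H, G)`-biset `H`, on which `G` acts on the right through `f : G → H`. -/
def FinBiset.ofHom [Finite H] (f : G →* H) : FinBiset H G where
  carrier := H
  right :=
    { smul := fun g h => h * f g.unop
      one_smul := fun h => by
        change h * f 1 = h
        rw [map_one, mul_one]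
      mul_smul := fun a b h => by
        change h * f (b.unop * a.unop) = h * f b.unop * f a.unop
        rw [map_mul, mul_assoc] }
  comm := @SMulCommClass.mk _ _ _ (_) (_) fun a b h => (mul_assoc a h (f b.unop)).symm

/-- The `(G, H)`-biset `H`, on which `G` acts on the left through `f : G → H`. -/
def FinBiset.ofHomLeft [Finite H] (f : G →* H) : FinBiset G H where
  carrier := H
  left :=
    { smul := fun g h => f g * h
      one_smul := fun h => by
        change f 1 * h = h
        rw [map_one, one_mul]
      mul_smul := fun a b h => by
        change f (a * b) * h = f a * (f b * h)
        rw [map_mul, mul_assoc] }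
  comm := @SMulCommClass.mk _ _ _ (_) (_) fun a b h => (mul_assoc (f a) h b.unop).symm

variable {K : Type u} [Group K] [Finite K] [Finite G] [Finite H] (𝔽 : Type v) [Field 𝔽]

/-- The class of `((1, 1), S)` generates the whole set, with stabilizer `(f × id)(S)`. This is
induction for `f` injective and deflation for `f` surjective. -/
theorem ShiftedBurnside.map_ofHom_cls_coset (f : G →* H) (S : Subgroup (G × K)) :
    ShiftedBurnside.map 𝔽 K (FinBiset.ofHom f) (Burnside.cls 𝔽 (FinGSet.coset S)) =
      Burnside.cls 𝔽 (FinGSet.coset (S.map (f.prodMap (MonoidHom.id K)))) := by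
  refine (Burnside.map_cls 𝔽 _ _).trans (Burnside.cls_eq 𝔽 ?_)
  refine FinGSet.equivalent_coset _
    (Quotient.mk (((FinBiset.ofHom f).prodGroup K).tensorSetoid (FinGSet.coset S))
      (((1 : H), (1 : K)), (((1 : G × K) : (G × K) ⧸ S)))) ?_ ?_
  · rintro ⟨⟨⟨(h : H), k⟩, ⟨g, k'⟩⟩⟩
    refine ⟨(h * f g, k * k'), Quotient.sound ⟨(g, k')⁻¹, ?_⟩⟩
    refine Prod.ext (Prod.ext ?_ ?_) ?_
    · change h = h * f g * 1 * f g⁻¹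
      simp
    · change k = k * k' * 1 * k'⁻¹
      simp
    · rw [inv_inv]
      exact congrArg (QuotientGroup.mk (s := S)) (mul_one (g, k')).symm
  · rintro ⟨h, k⟩
    constructor
    · intro heq
      obtain ⟨⟨g, k'⟩, hg⟩ := Quotient.exact heq
      have h₁ : (1 : H) = h * 1 * f g := congrArg (fun p => p.1.1) hg
      have h₂ : (1 : K) = k * 1 * k' := congrArg (fun p => p.1.2) hg
      have h₃ : (((1 : G × K)) : (G × K) ⧸ S) = (((g, k')⁻¹ * 1 : G × K) : (G × K) ⧸ S) :=
        congrArg (fun p => p.2) hg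
      rw [QuotientGroup.eq, inv_one, one_mul, mul_one] at h₃
      refine ⟨(g, k')⁻¹, h₃, Prod.ext ?_ ?_⟩
      · rw [mul_one] at h₁
        simpa using (eq_inv_of_mul_eq_one_left h₁.symm).symm
      · rw [mul_one] at h₂
        simpa using (eq_inv_of_mul_eq_one_left h₂.symm).symm
    · rintro ⟨⟨g, k'⟩, hS, heq⟩
      obtain ⟨rfl, rfl⟩ := Prod.mk.inj heq
      refine Quotient.sound ⟨(g, k')⁻¹, Prod.ext (Prod.ext ?_ ?_) ?_⟩
      · change 1 = f g * 1 * f g⁻¹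
        simp
      · change 1 = k' * 1 * k'⁻¹
        simp
      · rw [inv_inv]
        refine QuotientGroup.eq.2 ?_
        simpa using hS

/-- Here surjectivity gives transitivity, and the operation is inflation. -/
theorem ShiftedBurnside.map_ofHomLeft_cls_coset {f : G →* H} (hf : Function.Surjective f)
    (S : Subgroup (H × K)) :
    ShiftedBurnside.map 𝔽 K (FinBiset.ofHomLeft f) (Burnside.cls 𝔽 (FinGSet.coset S)) =
      Burnside.cls 𝔽 (FinGSet.coset (S.comap (f.prodMap (MonoidHom.id K)))) := by
  refine (Burnside.map_cls 𝔽 _ _).trans (Burnside.cls_eq 𝔽 ?_)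
  refine FinGSet.equivalent_coset _
    (Quotient.mk (((FinBiset.ofHomLeft f).prodGroup K).tensorSetoid (FinGSet.coset S))
      (((1 : H), (1 : K)), (((1 : H × K) : (H × K) ⧸ S)))) ?_ ?_
  · rintro ⟨⟨⟨(h : H), k⟩, ⟨h', k'⟩⟩⟩
    obtain ⟨g, hg⟩ := hf (h * h')
    refine ⟨(g, k * k'), Quotient.sound ⟨(h', k')⁻¹, ?_⟩⟩
    refine Prod.ext (Prod.ext ?_ ?_) ?_
    · change h = f g * 1 * h'⁻¹
      simp [hg]
    · change k = k * k' * 1 * k'⁻¹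
      simp
    · rw [inv_inv]
      exact congrArg (QuotientGroup.mk (s := S)) (mul_one (h', k')).symm
  · rintro ⟨g, k⟩
    constructor
    · intro heq
      obtain ⟨⟨h', k'⟩, hg⟩ := Quotient.exact heq
      have h₁ : (1 : H) = f g * 1 * h' := congrArg (fun p => p.1.1) hg
      have h₂ : (1 : K) = k * 1 * k' := congrArg (fun p => p.1.2) hg
      have h₃ : (((1 : H × K)) : (H × K) ⧸ S) = (((h', k')⁻¹ * 1 : H × K) : (H × K) ⧸ S) :=
        congrArg (fun p => p.2) hg
      rw [QuotientGroup.eq, inv_one, one_mul, mul_one] at h₃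
      rw [mul_one] at h₁ h₂
      change (f g, k) ∈ S
      rwa [eq_inv_of_mul_eq_one_left h₁.symm, eq_inv_of_mul_eq_one_left h₂.symm]
    · intro hS
      have hS' : (f g, k) ∈ S := hS
      refine Quotient.sound ⟨(f g, k)⁻¹, Prod.ext (Prod.ext ?_ ?_) ?_⟩
      · change 1 = f g * 1 * (f g)⁻¹
        simp
      · change 1 = k * 1 * k⁻¹
        simp
      · rw [inv_inv]
        refine QuotientGroup.eq.2 ?_
        simpa using hS'

end Bisets

/-! ## The ideals `𝖾_{L,φ}` -/

section Ideals

variable {L P K : Type u} [Group L] [Finite L] [Group P] [Finite P] [Group K] [Finite K]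
  (𝔽 : Type v) [Field 𝔽]

/-- The sum of `|X| μ(X, L) [(L × K) / X_φ]` over the subgroups `X` of `L`. -/
noncomputable def graphSum [Fintype (Subgroup L)] (φ : L →* K) : ShiftedBurnside 𝔽 K L :=
  ∑ X : Subgroup L, (subgroupMoebius X ⊤ * (Nat.card X : ℤ)) •
    Burnside.cls 𝔽 (FinGSet.coset (X.map ((MonoidHom.id L).prod φ)))

/-- The subgroups of the graph of `φ` are the graphs of its restrictions to the `X ≤ L`, so the sum
can be reindexed by the subgroups of `L`. -/
theorem burnsideIdempotent_graph [Fintype (Subgroup L)] (φ : L →* K) :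
    burnsideIdempotent 𝔽 φ.graph =
      (1 / (Nat.card (Subgroup.normalizer (φ.graph : Set (L × K))) : 𝔽)) • graphSum 𝔽 φ := by
  classical
  set γ := (MonoidHom.id L).prod φ with hγ
  have hinj : Function.Injective γ := fun a b h => congrArg Prod.fst h
  have hgraph : φ.graph = γ.range := by
    ext ⟨l, k⟩
    simp [MonoidHom.mem_graph, hγ, eq_comm]
  let _ : Fintype (Subgroup (L × K)) := Fintype.ofFinite _
  rw [burnsideIdempotent]
  congr 1
  rw [graphSum, finsum_eq_sum_of_fintype]
  simp_rw [finsum_eq_if]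
  rw [← Finset.sum_filter]
  symm
  refine Finset.sum_bij (fun X _ => X.map γ) (fun X _ => ?_) (fun X _ Y _ h => ?_) (fun Z hZ => ?_)
    fun X _ => ?_
  · rw [Finset.mem_filter, hgraph, MonoidHom.range_eq_map]
    exact ⟨Finset.mem_univ _, Subgroup.map_mono le_top⟩
  · exact Subgroup.map_injective hinj h
  · rw [Finset.mem_filter, hgraph] at hZ
    exact ⟨Z.comap γ, Finset.mem_univ _, Subgroup.map_comap_eq_self hZ.2⟩
  · rw [hgraph, subgroupMoebius_map hinj, ← Int.cast_smul_eq_zsmul 𝔽,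
      Nat.card_congr (X.equivMapOfInjective γ hinj).toEquiv.symm, mul_comm]
    push_cast
    rfl

theorem ShiftedIdeal.generated_eq_generated {a : ShiftedBurnside 𝔽 K L} {b : ShiftedBurnside 𝔽 K P}
    (h : ∀ I : ShiftedIdeal 𝔽 K, a ∈ I.obj L ↔ b ∈ I.obj P) :
    ShiftedIdeal.generated 𝔽 a = ShiftedIdeal.generated 𝔽 b := by
  refine ShiftedIdeal.ext ?_
  funext G _ _
  ext x
  exact forall_congr' fun I => by rw [h I]

/-- Inflating along `X → P` and inducing to `L` turns the graph over `Y` into the graph over `X ∩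
f⁻¹(Y)`. -/
theorem map_ofHom_map_ofHomLeft_graphSum [Fintype (Subgroup P)] {f : L →* P} (ψ : P →* K)
    {X : Subgroup L} (hX : X.map f = ⊤) :
    ShiftedBurnside.map 𝔽 K (FinBiset.ofHom X.subtype)
      (ShiftedBurnside.map 𝔽 K (FinBiset.ofHomLeft (f.comp X.subtype)) (graphSum 𝔽 ψ)) =
      ∑ Y : Subgroup P, (subgroupMoebius Y ⊤ * (Nat.card Y : ℤ)) • Burnside.cls 𝔽
        (FinGSet.coset ((X ⊓ Y.comap f).map ((MonoidHom.id L).prod (ψ.comp f)))) := by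
  have hg : Function.Surjective (f.comp X.subtype) := fun y => by
    obtain ⟨x, hx, rfl⟩ : y ∈ X.map f := hX ▸ Subgroup.mem_top y
    exact ⟨⟨x, hx⟩, rfl⟩
  rw [graphSum, map_sum, map_sum]
  refine Finset.sum_congr rfl fun Y _ => ?_
  rw [map_zsmul, map_zsmul, ShiftedBurnside.map_ofHomLeft_cls_coset 𝔽 hg,
    ShiftedBurnside.map_ofHom_cls_coset]
  congr 3
  ext ⟨l, k⟩
  constructor
  · rintro ⟨⟨x, k'⟩, ⟨y, hy, hxy⟩, hx⟩
    obtain ⟨h₁, h₂⟩ := Prod.mk.inj hxy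
    obtain ⟨rfl, rfl⟩ := Prod.mk.inj hx
    have h₁' : y = f x := h₁
    refine ⟨x, ⟨x.2, ?_⟩, Prod.ext rfl ?_⟩
    · change f x ∈ Y
      rw [← h₁']
      exact hy
    · exact (congrArg ψ h₁').symm.trans h₂
  · rintro ⟨x, ⟨hxX, hxY⟩, hx⟩
    obtain ⟨rfl, rfl⟩ := Prod.mk.inj hx
    exact ⟨(⟨x, hxX⟩, ψ (f x)), ⟨f x, hxY, rfl⟩, rfl⟩

/-- This is `sum_subgroupMoebius_smul` for `Z ↦ |Z| [(L × K)/Z_φ]`. It shows that the ideal of a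
group over `K` lies in that of any quotient, whatever the value of `m`. -/
theorem card_smul_graphSum_comp [Fintype (Subgroup L)] [Fintype (Subgroup P)] {f : L →* P}
    (hf : Function.Surjective f) (ψ : P →* K) :
    open scoped Classical in
    (Nat.card P : ℤ) • graphSum 𝔽 (ψ.comp f) =
      ∑ X : Subgroup L, (if X.map f = ⊤ then subgroupMoebius X ⊤ * (Nat.card X : ℤ) else 0) •
        ShiftedBurnside.map 𝔽 K (FinBiset.ofHom X.subtype)
          (ShiftedBurnside.map 𝔽 K (FinBiset.ofHomLeft (f.comp X.subtype)) (graphSum 𝔽 ψ)) := by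
  classical
  rw [graphSum]
  simp_rw [mul_smul (subgroupMoebius _ _)]
  rw [sum_subgroupMoebius_smul hf, Finset.smul_sum]
  refine Finset.sum_congr rfl fun X _ => ?_
  by_cases hX : X.map f = ⊤
  · rw [map_ofHom_map_ofHomLeft_graphSum 𝔽 ψ hX, if_pos hX, if_pos hX, Finset.smul_sum,
      Finset.smul_sum]
    refine Finset.sum_congr rfl fun Y _ => ?_
    rw [smul_smul, smul_smul, smul_smul]
    congr 1
    have h' : (Nat.card (X ⊓ Y.comap f : Subgroup L) : ℤ) * Nat.card P = Nat.card X * Nat.card Y :=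
      mod_cast Subgroup.card_inf_comap_mul_card hX Y
    linear_combination (subgroupMoebius X ⊤ * subgroupMoebius Y ⊤) * h'
  · simp [hX]

variable [CharZero 𝔽]

theorem ShiftedIdeal.burnsideIdempotent_graph_mem_iff [Fintype (Subgroup L)] (φ : L →* K)
    (I : ShiftedIdeal 𝔽 K) :
    burnsideIdempotent 𝔽 φ.graph ∈ I.obj L ↔ graphSum 𝔽 φ ∈ I.obj L := by
  rw [burnsideIdempotent_graph]
  exact Submodule.smul_mem_iff _ (one_div_ne_zero (Nat.cast_ne_zero.2 Nat.card_pos.ne'))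

variable [Fintype (Subgroup L)] [Fintype (Subgroup P)]

/-- Deflation sends the graph over `Z` to the graph over `f(Z)`, which is the situation of
`sum_card_smul_map`. -/
theorem map_ofHom_graphSum {f : L →* P} (hf : Function.Surjective f) (ψ : P →* K) :
    (Nat.card P : ℚ) • ShiftedBurnside.map 𝔽 K (FinBiset.ofHom f) (graphSum 𝔽 (ψ.comp f)) =
      (Nat.card L * mNumber f.ker) • graphSum 𝔽 ψ := by
  rw [graphSum, graphSum, map_sum, ← sum_card_smul_map hf]
  congr 1
  refine Finset.sum_congr rfl fun Z _ => ?_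
  rw [map_zsmul, ShiftedBurnside.map_ofHom_cls_coset, Subgroup.map_map, Subgroup.map_map]
  rfl

theorem ShiftedIdeal.graphSum_mem_of_graphSum_comp_mem {f : L →* P} (hf : Function.Surjective f)
    (hm : mNumber f.ker ≠ 0) (ψ : P →* K) (I : ShiftedIdeal 𝔽 K)
    (h : graphSum 𝔽 (ψ.comp f) ∈ I.obj L) : graphSum 𝔽 ψ ∈ I.obj P := by
  have hL : (Nat.card L : ℚ) ≠ 0 := Nat.cast_ne_zero.2 Nat.card_pos.ne'
  have h₁ := Submodule.smul_of_tower_mem (I.obj P) (Nat.card P : ℚ)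
    (I.map_mem (FinBiset.ofHom f) h)
  rw [map_ofHom_graphSum 𝔽 hf] at h₁
  -- The only place in the comparison of ideals where `m_{L, Ker f} ≠ 0` matters: the scalar is
  -- inverted.
  have h₂ := Submodule.smul_of_tower_mem (I.obj P) (Nat.card L * mNumber f.ker)⁻¹ h₁
  rwa [inv_smul_smul₀ (mul_ne_zero hL hm)] at h₂

theorem ShiftedIdeal.graphSum_comp_mem_of_graphSum_mem {f : L →* P} (hf : Function.Surjective f)
    (ψ : P →* K) (I : ShiftedIdeal 𝔽 K) (h : graphSum 𝔽 ψ ∈ I.obj P) :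
    graphSum 𝔽 (ψ.comp f) ∈ I.obj L := by
  have hP : (Nat.card P : 𝔽) ≠ 0 := Nat.cast_ne_zero.2 Nat.card_pos.ne'
  rw [← Submodule.smul_mem_iff _ hP, ← Int.cast_natCast, Int.cast_smul_eq_zsmul,
    card_smul_graphSum_comp 𝔽 hf]
  exact Submodule.sum_mem _ fun X _ => zsmul_mem (I.map_mem _ (I.map_mem _ h)) _

theorem GrpOver.ideal_quotient (X : GrpOver K) (Q : Subgroup X.carrier) [Q.Normal]
    (hQ : Q ≤ X.hom.ker) (hm : mNumber Q ≠ 0) : X.ideal 𝔽 = (X.quotient Q hQ).ideal 𝔽 := by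
  let _ : Fintype (Subgroup X.carrier) := Fintype.ofFinite _
  let _ : Fintype (Subgroup (X.quotient Q hQ).carrier) := Fintype.ofFinite _
  let f : X.carrier →* (X.quotient Q hQ).carrier := QuotientGroup.mk' Q
  have hf : Function.Surjective f := QuotientGroup.mk'_surjective Q
  have hker : f.ker = Q := QuotientGroup.ker_mk' Q
  have hcomp : X.hom = (X.quotient Q hQ).hom.comp f := MonoidHom.ext fun x => rfl
  refine ShiftedIdeal.generated_eq_generated 𝔽 fun I => ?_
  rw [ShiftedIdeal.burnsideIdempotent_graph_mem_iff, ShiftedIdeal.burnsideIdempotent_graph_mem_iff,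
    hcomp]
  exact ⟨I.graphSum_mem_of_graphSum_comp_mem 𝔽 hf (by rwa [hker]) _,
    I.graphSum_comp_mem_of_graphSum_mem 𝔽 hf _⟩

end Ideals

theorem mainTheorem2 (𝔽 : Type v) [Field 𝔽] [CharZero 𝔽] (K : Type u) [Group K] [Finite K]
    (X : GrpOver K) :
    -- a subgroup `Q` as in the definition of `β_K(L, φ)` exists
    (∃ Q : Subgroup X.carrier, X.IsBetaKernel Q) ∧
    -- `β_K(L, φ)` does not depend on `Q`, up to isomorphism of groups over `K`
    (∀ (Q Q' : Subgroup X.carrier) (hQ : X.IsBetaKernel Q) (hQ' : X.IsBetaKernel Q'),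
      Nonempty (X.beta Q hQ ≅ X.beta Q' hQ')) ∧
    ∀ (Q : Subgroup X.carrier) (hQ : X.IsBetaKernel Q),
      -- `β_K(L, φ)` is a `B_K`-group, quotient of `(L, φ)`
      (X.beta Q hQ).IsBGroup ∧ X.SurjectsOnto (X.beta Q hQ) ∧
      -- every `B_K`-group quotient of `(L, φ)` is a quotient of `β_K(L, φ)`
      (∀ P : GrpOver K, P.IsBGroup → X.SurjectsOnto P → (X.beta Q hQ).SurjectsOnto P) ∧
      -- `(L, φ)` and `β_K(L, φ)` define the same ideal of `𝔽B_K`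
      X.ideal 𝔽 = (X.beta Q hQ).ideal 𝔽 := by
  have hquot : ∀ (Q : Subgroup X.carrier) (hQ : X.IsBetaKernel Q),
      X.SurjectsOnto (X.beta Q hQ) := fun Q hQ =>
    have := hQ.prop.1
    X.surjectsOnto_quotient Q hQ.prop.2.1
  have huniv : ∀ (Q : Subgroup X.carrier) (hQ : X.IsBetaKernel Q) (P : GrpOver K), P.IsBGroup →
      X.SurjectsOnto P → (X.beta Q hQ).SurjectsOnto P := fun Q hQ P hP hXP =>
    have := hQ.prop.1
    GrpOver.surjectsOnto_of_mNumber_ne_zero hQ.prop.2.1 hQ.prop.2.2 hP hXP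
  refine ⟨X.exists_isBetaKernel, fun Q Q' hQ hQ' => ?_, fun Q hQ => ?_⟩
  -- Each candidate is a `B_K`-group quotient of `(L, φ)`, so the universal property of the other
  -- gives surjections both ways.
  · exact GrpOver.nonempty_iso
      (huniv Q hQ _ (GrpOver.isBGroup_beta hQ') (hquot Q' hQ'))
      (huniv Q' hQ' _ (GrpOver.isBGroup_beta hQ) (hquot Q hQ))
  · have := hQ.prop.1
    exact ⟨GrpOver.isBGroup_beta hQ, hquot Q hQ, huniv Q hQ,
      X.ideal_quotient 𝔽 Q hQ.prop.2.1 hQ.prop.2.2⟩
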